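/- **Conventions.** Let $\omega=dx_1\wedge dx_2$ on $\mathbb R^2$ and $\omega_\theta=d\theta_1\wedge d\theta_2$ on $(\mathbb R/2\pi\mathbb Z)^2$, and let $\mathrm{Log}(z_1,z_2)=(\log|z_1|,\log|z_2|)$ and $\arg(z_1,z_2)=(\arg z_1,\arg z_2)$ on $(\mathbb C^*)^2$. Let $\mathbb H=\{\mathrm{Im}\,t>0\}$ with its complex orientation. For a real parametrized rational curve $\varphi:\mathbb{CP}^1\dashrightarrow(\mathbb C^*)^2$ and a component $S$ of $\mathbb{CP}^1\setminus\mathbb{RP}^1$, the signed areas are $$\int_{\varphi(S)}\mathrm{Log}^*\omega:=\int_S(\mathrm{Log}\circ\varphi)^*\omega,\qquad \int_{\varphi(S)}\arg{}^*\omega_\theta:=\int_S(\arg\circ\varphi)^*\omega_\theta,$$ the integrals being taken over the points of $S$ sent to $(\mathbb C^*)^2$. The curve has real or purely imaginary intersection points with the toric boundary if, for every $p\in\mathbb{CP}^1$ sent to the boundary, each monomial $z_1^az_2^b$ ($a,b\in\mathbb Z$) having neither a zero nor a pole along $\varphi$ at $p$ takes at $p$ a value whose square is real. The quantum index $k(S,\varphi)$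 of such a curve is the number in $\tfrac12\mathbb Z$ for which both areas above are equal to $k(S,\varphi)\,\pi^2$. **Lemma.** Let $m_1\ge 1$ and $0\le k\le m_1-1$ be integers, let $c_k=\cot\left(\frac{\pi(2k+1)}{2m_1}\right)$ and $$\varphi_k(t)=\left(t-c_k,\ \frac{t^2+1}{t-c_k}\right).$$ Then the following integrals converge absolutely and $$\int_{\varphi_k(\mathbb H)}\mathrm{Log}^*\omega=\int_{\varphi_k(\mathbb H)}\arg{}^*\omega_\theta=\left(\frac{2k+1}{m_1}-1\right)\pi^2.$$ Moreover, for all integers $m_2,m_3\ge 1$, the real rational curve $$\psi_k(t)=\left((t-c_k)^{m_1},\ (t-c_k)^{2m_2}(t^2+1)^{m_3-m_2}\right)$$ has real or purely imaginary intersection points with the toric boundary, and its quantum index with respect to $\mathbb H$ is $$k(\mathbb H,\psi_k)=(m_3-m_2)(2k+1-m_1).$$ -/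

import Mathlib

open Filter Topology MeasureTheory

noncomputable section

namespace QuantumIndex

/-- The standard area form `dx₁ ∧ dx₂` on `ℝ²`. -/
def areaForm (u v : ℝ × ℝ) : ℝ := u.1 * v.2 - u.2 * v.1

/-- The density, with respect to `dx ∧ dy` at the point `t = x + i y` of the plane, of the pull-back
`F^*(dx₁ ∧ dx₂)`: its value on the positive basis `(1, i)` of the tangent space. -/
def pullbackDensity (F : ℂ → ℝ × ℝ) (t : ℂ) : ℝ :=
  areaForm (fderiv ℝ F t 1) (fderiv ℝ F t Complex.I)

/-- The map `Log`: coordinatewise logarithm of the absolute value. -/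
def logMap (z : ℂ × ℂ) : ℝ × ℝ := (Real.log ‖z.1‖, Real.log ‖z.2‖)

/-- The map `arg` to the argument torus `(ℝ/2πℤ)²`: coordinatewise argument. -/
def argMap (z : ℂ × ℂ) : Real.Angle × Real.Angle :=
  ((z.1.arg : Real.Angle), (z.2.arg : Real.Angle))

/-- The chart of the torus `(ℝ/2πℤ)²` centred at `θ₀`, inverse near `0` to `x ↦ θ₀ + (x mod 2π)`.
The invariant area form `dθ₁ ∧ dθ₂` reads `dx₁ ∧ dx₂` in this chart. -/
def angleChart (θ₀ θ : Real.Angle × Real.Angle) : ℝ × ℝ :=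
  ((θ.1 - θ₀.1).toReal, (θ.2 - θ₀.2).toReal)

/-- The density of `(Log ∘ φ)^*(dx₁ ∧ dx₂)` at `t`. -/
def logDensity (φ : ℂ → ℂ × ℂ) (t : ℂ) : ℝ :=
  pullbackDensity (fun s => logMap (φ s)) t

/-- The density of `(arg ∘ φ)^*(dθ₁ ∧ dθ₂)` at `t`, computed in the chart of the argument torus
centred at `arg (φ t)`. -/
def argDensity (φ : ℂ → ℂ × ℂ) (t : ℂ) : ℝ :=
  pullbackDensity (fun s => angleChart (argMap (φ t)) (argMap (φ s))) t

/-- The part of `S` that `φ` sends to the complex torus `(ℂ^*)²`. -/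
def torusPart (φ : ℂ → ℂ × ℂ) (S : Set ℂ) : Set ℂ :=
  {t | t ∈ S ∧ (φ t).1 ≠ 0 ∧ (φ t).2 ≠ 0}

/-- The signed logarithmic area `∫_{φ(S)} Log^*(dx₁ ∧ dx₂)` of the parametrized curve `φ` over `S`
exists (as an absolutely convergent integral) and is equal to `A`. -/
def HasLogArea (φ : ℂ → ℂ × ℂ) (S : Set ℂ) (A : ℝ) : Prop :=
  IntegrableOn (logDensity φ) (torusPart φ S) ∧ ∫ t in torusPart φ S, logDensity φ t = A

/-- The signed area `∫_{φ(S)} arg^*(dθ₁ ∧ dθ₂)` of the coamoeba of `φ` over `S`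
exists (as an absolutely convergent integral) and is equal to `A`. -/
def HasArgArea (φ : ℂ → ℂ × ℂ) (S : Set ℂ) (A : ℝ) : Prop :=
  IntegrableOn (argDensity φ) (torusPart φ S) ∧ ∫ t in torusPart φ S, argDensity φ t = A

/-- The function `f` is (away from the poles of a fraction) a nonzero rational function
with real coefficients. -/
def IsRealRationalFun (f : ℂ → ℂ) : Prop :=
  ∃ p q : Polynomial ℝ, p ≠ 0 ∧ q ≠ 0 ∧
    ∀ t : ℂ, Polynomial.aeval t q ≠ 0 → f t = Polynomial.aeval t p / Polynomial.aeval t q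

/-- Real parametrized rational curves `ℂP¹ ⇢ (ℂ^*)²`. -/
def IsRealRationalCurve (φ : ℂ → ℂ × ℂ) : Prop :=
  IsRealRationalFun (fun t => (φ t).1) ∧ IsRealRationalFun (fun t => (φ t).2)

/-- Punctured neighbourhoods in `ℂ` of a point of the Riemann sphere `ℂP¹ = ℂ ∪ {∞}`. -/
def puncturedNhds (p : OnePoint ℂ) : Filter ℂ :=
  comap (fun t : ℂ => (t : OnePoint ℂ)) (𝓝[≠] p)

/-- The point `p` of `ℂP¹` is sent to the toric boundary, i.e. `φ` does not extend at `p` to a map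
with values in the torus `(ℂ^*)²`. -/
def MeetsBoundaryAt (φ : ℂ → ℂ × ℂ) (p : OnePoint ℂ) : Prop :=
  ¬ ∃ z : ℂ × ℂ, z.1 ≠ 0 ∧ z.2 ≠ 0 ∧ Tendsto φ (puncturedNhds p) (𝓝 z)

/-- The intersection points with the toric boundary are real or purely imaginary: their images under
the square map are real. If `p` is sent to the boundary then its image lies in the dense orbit of a
toric divisor, whose coordinates are the monomials `z₁^a z₂^b` that have neither a zero nor a pole
at `p`; the square of the value of each of them has to be real. -/
def HasRealOrImaginaryBoundary (φ : ℂ → ℂ × ℂ) : Prop :=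
  ∀ p : OnePoint ℂ, MeetsBoundaryAt φ p → ∀ (a b : ℤ) (w : ℂ), w ≠ 0 →
    Tendsto (fun t => (φ t).1 ^ a * (φ t).2 ^ b) (puncturedNhds p) (𝓝 w) → (w ^ 2).im = 0

/-- The open upper half-plane. -/
def upperHalf : Set ℂ := {t | 0 < t.im}

/-- The open lower half-plane. -/
def lowerHalf : Set ℂ := {t | t.im < 0}

/-- `κ` is the quantum index `k(S, φ)` of the real rational curve `φ`, oriented by the component `S`
of `ℂP¹ ∖ ℝP¹`. The curve has to have real or purely imaginary intersection points with the toric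
boundary, and `κ` is the half-integer such that the logarithmic area of `S` and the area of its
coamoeba are both equal to `κ π²`. -/
structure IsQuantumIndex (S : Set ℂ) (φ : ℂ → ℂ × ℂ) (κ : ℚ) : Prop where
  component : S = upperHalf ∨ S = lowerHalf
  rational : IsRealRationalCurve φ
  boundary : HasRealOrImaginaryBoundary φ
  halfInteger : ∃ n : ℤ, κ = n / 2
  logArea : HasLogArea φ S (κ * Real.pi ^ 2)
  argArea : HasArgArea φ S (κ * Real.pi ^ 2)

/-- The number `c_k = cot (π (2k+1) / (2 m₁))`. -/
def cParam (m₁ k : ℕ) : ℝ := Real.cot (Real.pi * (2 * k + 1) / (2 * m₁))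

/-- The curve `φ_k`. -/
def phiCurve (m₁ k : ℕ) (t : ℂ) : ℂ × ℂ :=
  (t - cParam m₁ k, (t ^ 2 + 1) / (t - cParam m₁ k))

/-- The curve `ψ_k`, of degree `{(m₁, 2m₂), (0, m₃ - m₂), (0, m₃ - m₂), (-m₁, -2m₃)}`. -/
def psiCurve (m₁ m₂ m₃ k : ℕ) (t : ℂ) : ℂ × ℂ :=
  ((t - cParam m₁ k) ^ m₁,
    (t - cParam m₁ k) ^ (2 * m₂) * (t ^ 2 + 1) ^ ((m₃ : ℤ) - (m₂ : ℤ)))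

end QuantumIndex

end

open scoped ComplexConjugate

namespace QuantumIndex

/-! Since log z = log|z| + i arg z is holomorphic, both area densities of a holomorphic curve equal
Im(α · conj β), where α and β are the logarithmic derivatives of its coordinates (`logDensity_eq`,
`argDensity_eq`). This is why the two areas agree.

For φ_k and ψ_k one has α = A/(t - c) and β = B/(t - c) + C(1/(t - i) + 1/(t + i)) with A, B, C
real. The B-term contributes a real number to α · conj β, so the density is AC times the sum of the
kernels Im(1/(t - c) · conj(1/(t - p))) for p = ±i. Each kernel is absolutely integrable on ℂ
(`integrable_areaKernel`). By Fubini, with a residue computation on horizontal lines, each has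
integral -π arctan c over the upper half-plane (`setIntegral_areaKernel`). Finally arctan(cot α_k) =
π/2 - α_k, where α_k = π(2k+1)/(2m₁).

The same angle governs the boundary condition: i - c_k is a real multiple of exp(-iα_k), so its
power 2m₁ is real. Boundary points on ℝP¹ only give limits of real values. -/

/-! ### Densities in terms of logarithmic derivatives -/

theorem pullbackDensity_of_hasFDerivAt {F₁ F₂ : ℂ → ℝ} {L₁ L₂ : ℂ →L[ℝ] ℝ} {F : ℂ → ℝ × ℝ} {t : ℂ}
    (hF : F =ᶠ[𝓝 t] fun s => (F₁ s, F₂ s)) (h₁ : HasFDerivAt F₁ L₁ t) (h₂ : HasFDerivAt F₂ L₂ t) :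
    pullbackDensity F t = L₁ 1 * L₂ Complex.I - L₂ 1 * L₁ Complex.I := by
  have h : fderiv ℝ F t = L₁.prod L₂ := by
    rw [hF.fderiv_eq]
    exact (h₁.prodMk h₂).fderiv
  simp only [pullbackDensity, areaForm, h, ContinuousLinearMap.prod_apply]

/-- Normalizing by `z t` keeps the argument of the logarithm near 1, away from the branch cut, so no
choice of branch is needed. -/
theorem hasDerivAt_log_div {z : ℂ → ℂ} {z' t : ℂ} (hz : HasDerivAt z z' t) (h0 : z t ≠ 0) :
    HasDerivAt (fun s => Complex.log (z s / z t)) (z' / z t) t := by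
  have h := (hz.div_const (z t)).clog (by simp [div_self h0])
  simpa [div_self h0] using h

theorem hasFDerivAt_re_log_div {z : ℂ → ℂ} {z' t : ℂ} (hz : HasDerivAt z z' t) (h0 : z t ≠ 0) :
    HasFDerivAt (fun s => (Complex.log (z s / z t)).re)
      (Complex.reCLM.comp ((ContinuousLinearMap.toSpanSingleton ℂ (z' / z t)).restrictScalars ℝ))
      t := by
  have h := (hasDerivAt_log_div hz h0).hasFDerivAt.restrictScalars ℝ
  exact (Complex.reCLM.hasFDerivAt (x := Complex.log (z t / z t))).comp t h

theorem hasFDerivAt_im_log_div {z : ℂ → ℂ} {z' t : ℂ} (hz : HasDerivAt z z' t) (h0 : z t ≠ 0) :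
    HasFDerivAt (fun s => (Complex.log (z s / z t)).im)
      (Complex.imCLM.comp ((ContinuousLinearMap.toSpanSingleton ℂ (z' / z t)).restrictScalars ℝ))
      t := by
  have h := (hasDerivAt_log_div hz h0).hasFDerivAt.restrictScalars ℝ
  exact (Complex.imCLM.hasFDerivAt (x := Complex.log (z t / z t))).comp t h

theorem log_norm_eq_re_log_div {w z : ℂ} (hw : w ≠ 0) (hz : z ≠ 0) :
    Real.log ‖w‖ = (Complex.log (w / z)).re + Real.log ‖z‖ := by
  rw [Complex.log_re, norm_div, Real.log_div (by simpa) (by simpa)]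
  ring

theorem toReal_arg_sub_eq_im_log_div {w z : ℂ} (hw : w ≠ 0) (hz : z ≠ 0) :
    ((w.arg : Real.Angle) - (z.arg : Real.Angle)).toReal = (Complex.log (w / z)).im := by
  rw [Complex.log_im, ← Complex.arg_div_coe_angle hw hz, Complex.arg_coe_angle_toReal_eq_arg]

theorem logDensity_eq {φ : ℂ → ℂ × ℂ} {a b t : ℂ} (h₁ : HasDerivAt (fun s => (φ s).1) a t)
    (h₂ : HasDerivAt (fun s => (φ s).2) b t) (h₁0 : (φ t).1 ≠ 0) (h₂0 : (φ t).2 ≠ 0) :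
    logDensity φ t = (a / (φ t).1 * conj (b / (φ t).2)).im := by
  have e₁ := h₁.continuousAt.eventually_ne h₁0
  have e₂ := h₂.continuousAt.eventually_ne h₂0
  have d₁ := (hasFDerivAt_re_log_div h₁ h₁0).add_const (Real.log ‖(φ t).1‖)
  have d₂ := (hasFDerivAt_re_log_div h₂ h₂0).add_const (Real.log ‖(φ t).2‖)
  rw [logDensity, pullbackDensity_of_hasFDerivAt _ d₁ d₂]
  · simp [-map_div₀]
    ring
  · filter_upwards [e₁, e₂] with s hs₁ hs₂
    simp only [logMap, log_norm_eq_re_log_div hs₁ h₁0, log_norm_eq_re_log_div hs₂ h₂0]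

theorem argDensity_eq {φ : ℂ → ℂ × ℂ} {a b t : ℂ} (h₁ : HasDerivAt (fun s => (φ s).1) a t)
    (h₂ : HasDerivAt (fun s => (φ s).2) b t) (h₁0 : (φ t).1 ≠ 0) (h₂0 : (φ t).2 ≠ 0) :
    argDensity φ t = (a / (φ t).1 * conj (b / (φ t).2)).im := by
  have e₁ := h₁.continuousAt.eventually_ne h₁0
  have e₂ := h₂.continuousAt.eventually_ne h₂0
  have d₁ := hasFDerivAt_im_log_div h₁ h₁0
  have d₂ := hasFDerivAt_im_log_div h₂ h₂0
  rw [argDensity, pullbackDensity_of_hasFDerivAt _ d₁ d₂]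
  · simp [-map_div₀]
    ring
  · filter_upwards [e₁, e₂] with s hs₁ hs₂
    simp only [angleChart, argMap, toReal_arg_sub_eq_im_log_div hs₁ h₁0,
      toReal_arg_sub_eq_im_log_div hs₂ h₂0]

/-! ### Absolute integrability of the kernel -/

/-- The imaginary part of the product of `1 / (t - c)` and the conjugate of `1 / (t - p)`. -/
noncomputable def areaKernel (c p t : ℂ) : ℝ := ((t - c)⁻¹ * conj ((t - p)⁻¹)).im

/-- In polar coordinates the Jacobian r cancels the singularity and leaves 1/(1 + r²). -/
theorem integrable_radial_bound :
    Integrable (fun t : ℂ => (‖t‖ * (1 + ‖t‖ ^ 2))⁻¹) := by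
  have h := (integrable_fun_norm_addHaar (volume : Measure ℂ)
    (f := fun r : ℝ => (r * (1 + r ^ 2))⁻¹)).2
  apply h
  rw [Complex.finrank_real_complex]
  refine (integrable_inv_one_add_sq.integrableOn (s := Set.Ioi 0)).congr_fun ?_ measurableSet_Ioi
  intro r hr
  have : (r : ℝ) ≠ 0 := ne_of_gt hr
  simp only [smul_eq_mul]
  field_simp
  norm_num

/-- The numerator conj(u) · v equals |u|² - conj(u) · d, whose imaginary part is only O(|u|). This
gives cubic decay at infinity, where absolute values alone would give |t|⁻², which is not
integrable. The larger norm |v| is at least |u| and at least |d|/2, which gives the constant 4/|d|².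
-/
theorem abs_areaKernel_le_aux {u v d : ℂ} (hd : d ≠ 0) (huv : u - v = d) (hu : u ≠ 0)
    (h : ‖u‖ ≤ ‖v‖) :
    |(u⁻¹ * conj (v⁻¹)).im| ≤ ‖d‖ * (1 + 4 / ‖d‖ ^ 2) * (‖u‖ * (1 + ‖u‖ ^ 2))⁻¹ := by
  have hu' : 0 < ‖u‖ := norm_pos_iff.2 hu
  have hd' : 0 < ‖d‖ := norm_pos_iff.2 hd
  have hv' : 0 < ‖v‖ := hu'.trans_le h
  have e2 : (u⁻¹ * conj (v⁻¹)).im = - (conj u * d).im / (‖u‖ ^ 2 * ‖v‖ ^ 2) := by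
    rw [← huv, Complex.inv_def, Complex.inv_def, ← Complex.normSq_eq_norm_sq,
      ← Complex.normSq_eq_norm_sq]
    simp
    field_simp
    ring
  have h1 : |(u⁻¹ * conj (v⁻¹)).im| ≤ ‖u‖ * ‖d‖ / (‖u‖ ^ 2 * ‖v‖ ^ 2) := by
    rw [e2, abs_div, abs_neg, abs_of_pos (a := ‖u‖ ^ 2 * ‖v‖ ^ 2) (by positivity)]
    gcongr
    refine (Complex.abs_im_le_norm _).trans ?_
    simp
  have h2 : ‖d‖ ≤ 2 * ‖v‖ := by
    have := norm_sub_le u v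
    rw [huv] at this
    linarith
  have h3 : 1 + ‖u‖ ^ 2 ≤ (1 + 4 / ‖d‖ ^ 2) * ‖v‖ ^ 2 := by
    have : 1 ≤ 4 / ‖d‖ ^ 2 * ‖v‖ ^ 2 := by
      rw [div_mul_eq_mul_div, le_div_iff₀ (by positivity)]
      nlinarith
    nlinarith
  refine h1.trans ?_
  rw [← div_eq_mul_inv, div_le_div_iff₀ (by positivity) (by positivity)]
  have : ‖u‖ * ‖d‖ * (‖u‖ * (1 + ‖u‖ ^ 2)) = ‖d‖ * ‖u‖ ^ 2 * (1 + ‖u‖ ^ 2) := by ring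
  rw [this]
  calc _ ≤ ‖d‖ * ‖u‖ ^ 2 * ((1 + 4 / ‖d‖ ^ 2) * ‖v‖ ^ 2) := by gcongr
    _ = _ := by ring

theorem abs_areaKernel_le {c p t : ℂ} (h : c ≠ p) (hc : t ≠ c) (hp : t ≠ p) :
    |areaKernel c p t| ≤ ‖p - c‖ * (1 + 4 / ‖p - c‖ ^ 2) *
      ((‖t - c‖ * (1 + ‖t - c‖ ^ 2))⁻¹ + (‖t - p‖ * (1 + ‖t - p‖ ^ 2))⁻¹) := by
  rw [mul_add]
  rcases le_total ‖t - c‖ ‖t - p‖ with hle | hle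
  · refine (abs_areaKernel_le_aux (sub_ne_zero.2 h.symm) (by ring) (sub_ne_zero.2 hc) hle).trans ?_
    exact le_add_of_nonneg_right (by positivity)
  · have e : |areaKernel c p t| = |((t - p)⁻¹ * conj ((t - c)⁻¹)).im| := by
      rw [areaKernel, ← abs_neg, ← Complex.conj_im, map_mul, Complex.conj_conj, mul_comm]
    rw [e, norm_sub_rev p c]
    refine (abs_areaKernel_le_aux (sub_ne_zero.2 h) (by ring) (sub_ne_zero.2 hp) hle).trans ?_
    exact le_add_of_nonneg_left (by positivity)

theorem measurable_areaKernel (c p : ℂ) : Measurable (areaKernel c p) := by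
  unfold areaKernel
  have : Measurable (fun z : ℂ => conj z) := Complex.continuous_conj.measurable
  fun_prop

theorem integrable_areaKernel {c p : ℂ} (h : c ≠ p) : Integrable (areaKernel c p) := by
  have hb := ((integrable_radial_bound.comp_sub_right c).add
    (integrable_radial_bound.comp_sub_right p)).const_mul (‖p - c‖ * (1 + 4 / ‖p - c‖ ^ 2))
  refine hb.mono' (measurable_areaKernel c p).aestronglyMeasurable ?_
  filter_upwards [Measure.ae_ne volume c, Measure.ae_ne volume p] with t hc hp
  exact abs_areaKernel_le h hc hp

/-! ### Residue integrals along the real line -/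

theorem tendsto_one_sub_div_atTop (w : ℂ) :
    Tendsto (fun x : ℝ => 1 - w / (x : ℂ)) atTop (𝓝 1) := by
  have h : Tendsto (fun x : ℝ => w / (x : ℂ)) atTop (𝓝 0) := by
    rw [tendsto_zero_iff_norm_tendsto_zero]
    simp only [norm_div, Complex.norm_real, Real.norm_eq_abs]
    exact tendsto_abs_atTop_atTop.const_div_atTop _
  simpa using h.const_sub 1

theorem tendsto_log_sub_sub_log_atTop (w : ℂ) :
    Tendsto (fun x : ℝ => Complex.log (x - w) - (Real.log x : ℂ)) atTop (𝓝 0) := by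
  have h1 := tendsto_one_sub_div_atTop w
  have h : Tendsto (fun x : ℝ => Complex.log (1 - w / (x : ℂ))) atTop (𝓝 0) := by
    simpa only [Complex.log_one, Function.comp_def] using
      (continuousAt_clog (x := 1) Complex.one_mem_slitPlane).tendsto.comp h1
  refine h.congr' ?_
  filter_upwards [eventually_gt_atTop 0, h1.eventually_ne one_ne_zero] with x hx hx0
  have hxc : (x : ℂ) ≠ 0 := by exact_mod_cast hx.ne'
  rw [show (x : ℂ) - w = (x : ℝ) * (1 - w / (x : ℂ)) by field_simp, Complex.log_ofReal_mul hx hx0]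
  ring

theorem log_neg_of_im_neg {z : ℂ} (hz : z.im < 0) :
    Complex.log (-z) = Complex.log z + Real.pi * Complex.I := by
  simp only [Complex.log, norm_neg, Complex.arg_neg_eq_arg_add_pi_of_im_neg hz]
  push_cast
  ring

theorem log_neg_of_im_pos {z : ℂ} (hz : 0 < z.im) :
    Complex.log (-z) = Complex.log z - Real.pi * Complex.I := by
  simp only [Complex.log, norm_neg, Complex.arg_neg_eq_arg_sub_pi_of_im_pos hz]
  push_cast
  ring

theorem tendsto_log_sub_sub_log_atBot_of_im_neg {w : ℂ} (hw : w.im < 0) :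
    Tendsto (fun x : ℝ => Complex.log (x - w) - (Real.log (-x) : ℂ)) atBot
      (𝓝 (Real.pi * Complex.I)) := by
  have h := ((tendsto_log_sub_sub_log_atTop (-w)).comp tendsto_neg_atBot_atTop).add_const
    (Real.pi * Complex.I)
  rw [zero_add] at h
  refine h.congr fun x => ?_
  have e : (x : ℂ) - w = -(((-x : ℝ) : ℂ) - -w) := by push_cast; ring
  rw [e, log_neg_of_im_neg (by simpa using hw)]
  simp only [Function.comp]
  ring

theorem tendsto_log_sub_sub_log_atBot_of_im_pos {w : ℂ} (hw : 0 < w.im) :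
    Tendsto (fun x : ℝ => Complex.log (x - w) - (Real.log (-x) : ℂ)) atBot
      (𝓝 (-(Real.pi * Complex.I))) := by
  have h := ((tendsto_log_sub_sub_log_atTop (-w)).comp tendsto_neg_atBot_atTop).add_const
    (-(Real.pi * Complex.I))
  rw [zero_add] at h
  refine h.congr fun x => ?_
  have e : (x : ℂ) - w = -(((-x : ℝ) : ℂ) - -w) := by push_cast; ring
  rw [e, log_neg_of_im_pos (by simpa using hw)]
  simp only [Function.comp]
  ring

theorem sub_ne_zero_of_im_ne {w : ℂ} (hw : w.im ≠ 0) (x : ℝ) : (x : ℂ) - w ≠ 0 := fun h => hw (by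
  simpa using congrArg Complex.im h)

theorem integrable_norm_inv_sub_sq {w : ℂ} (hw : w.im ≠ 0) :
    Integrable (fun x : ℝ => ‖((x : ℂ) - w)⁻¹‖ ^ 2) := by
  have h := (((integrable_inv_one_add_sq.comp_div hw).comp_sub_right w.re).const_mul (w.im ^ 2)⁻¹)
  refine h.congr (Eventually.of_forall fun x => ?_)
  have hn : ‖(x : ℂ) - w‖ ^ 2 = (x - w.re) ^ 2 + w.im ^ 2 := by
    rw [← Complex.normSq_eq_norm_sq, Complex.normSq_apply]
    simp
    ring
  have : 0 < w.im ^ 2 := by positivity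
  simp only [norm_inv, inv_pow, hn]
  rw [← mul_inv]
  congr 1
  field_simp
  ring

theorem integrable_inv_sub_mul_inv_sub {w₁ w₂ : ℂ} (h₁ : w₁.im ≠ 0) (h₂ : w₂.im ≠ 0) :
    Integrable (fun x : ℝ => ((x : ℂ) - w₁)⁻¹ * ((x : ℂ) - w₂)⁻¹) := by
  refine ((integrable_norm_inv_sub_sq h₁).add (integrable_norm_inv_sub_sq h₂)).mono' ?_ ?_
  · refine Continuous.aestronglyMeasurable ?_
    exact ((Complex.continuous_ofReal.sub continuous_const).inv₀ (sub_ne_zero_of_im_ne h₁)).mul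
      ((Complex.continuous_ofReal.sub continuous_const).inv₀ (sub_ne_zero_of_im_ne h₂))
  · refine Eventually.of_forall fun x => ?_
    rw [norm_mul]
    simp only [Pi.add_apply]
    nlinarith [two_mul_le_add_sq ‖((x : ℂ) - w₁)⁻¹‖ ‖((x : ℂ) - w₂)⁻¹‖,
      norm_nonneg ((x : ℂ) - w₁)⁻¹, norm_nonneg ((x : ℂ) - w₂)⁻¹,
      mul_nonneg (norm_nonneg ((x : ℂ) - w₁)⁻¹) (norm_nonneg ((x : ℂ) - w₂)⁻¹)]

theorem hasDerivAt_log_sub {w : ℂ} (hw : w.im ≠ 0) (x : ℝ) :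
    HasDerivAt (fun x : ℝ => Complex.log (x - w)) (((x : ℂ) - w)⁻¹) x := by
  have h := ((hasDerivAt_id x).ofReal_comp.sub_const w).clog_real
    (Or.inr (by simpa using hw))
  simpa using h

/-- Partial fractions give the primitive (log(x - w₁) - log(x - w₂))/(w₁ - w₂). It vanishes at +∞,
so only the limit at -∞ counts. There each logarithm contributes ±πi according to the side of its
pole. -/
theorem integral_inv_sub_mul_inv_sub {w₁ w₂ m : ℂ} (h₁ : w₁.im ≠ 0) (h₂ : w₂.im ≠ 0) (h : w₁ ≠ w₂)
    (hm : Tendsto (fun x : ℝ => Complex.log (x - w₁) - Complex.log (x - w₂)) atBot (𝓝 m)) :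
    ∫ x : ℝ, ((x : ℂ) - w₁)⁻¹ * ((x : ℂ) - w₂)⁻¹ = m / (w₂ - w₁) := by
  have h0 : w₁ - w₂ ≠ 0 := sub_ne_zero.2 h
  have h0' : w₂ - w₁ ≠ 0 := sub_ne_zero.2 h.symm
  have htop : Tendsto (fun x : ℝ => Complex.log (x - w₁) - Complex.log (x - w₂)) atTop (𝓝 0) := by
    simpa using (tendsto_log_sub_sub_log_atTop w₁).sub (tendsto_log_sub_sub_log_atTop w₂)
  rw [integral_of_hasDerivAt_of_tendsto
    (f := fun x : ℝ => (Complex.log (x - w₁) - Complex.log (x - w₂)) / (w₁ - w₂)) (fun x => ?_)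
    (integrable_inv_sub_mul_inv_sub h₁ h₂) (hm.div_const _) (htop.div_const _)]
  · field_simp
    ring
  · refine (((hasDerivAt_log_sub h₁ x).fun_sub
      (hasDerivAt_log_sub h₂ x)).div_const (w₁ - w₂)).congr_deriv ?_
    have := sub_ne_zero_of_im_ne h₁ x
    have := sub_ne_zero_of_im_ne h₂ x
    field_simp
    ring

theorem integral_inv_sub_mul_inv_sub_of_im_neg_of_im_pos {w₁ w₂ : ℂ} (h₁ : w₁.im < 0)
    (h₂ : 0 < w₂.im) :
    ∫ x : ℝ, ((x : ℂ) - w₁)⁻¹ * ((x : ℂ) - w₂)⁻¹ = 2 * Real.pi * Complex.I / (w₂ - w₁) := by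
  refine integral_inv_sub_mul_inv_sub h₁.ne h₂.ne' (fun h => ?_) ?_
  · rw [h] at h₁
    exact lt_asymm h₁ h₂
  · have := (tendsto_log_sub_sub_log_atBot_of_im_neg h₁).sub
      (tendsto_log_sub_sub_log_atBot_of_im_pos h₂)
    convert this using 2
    · ring
    · ring

theorem integral_inv_sub_mul_inv_sub_of_im_neg_of_im_neg {w₁ w₂ : ℂ} (h₁ : w₁.im < 0)
    (h₂ : w₂.im < 0) (h : w₁ ≠ w₂) :
    ∫ x : ℝ, ((x : ℂ) - w₁)⁻¹ * ((x : ℂ) - w₂)⁻¹ = 0 := by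
  rw [integral_inv_sub_mul_inv_sub h₁.ne h₂.ne h (m := 0), zero_div]
  simpa using (tendsto_log_sub_sub_log_atBot_of_im_neg h₁).sub
      (tendsto_log_sub_sub_log_atBot_of_im_neg h₂)

/-! ### The kernel integrated over the upper half-plane -/

/-- On a horizontal line conj t = x - iy, so the kernel becomes the imaginary part of a rational
function of x, with poles c - iy and i(y - q). -/
theorem areaKernel_add_mul_I (c q x y : ℝ) :
    areaKernel c (q * Complex.I) (x + y * Complex.I) =
      (((x : ℂ) - (c - y * Complex.I))⁻¹ * ((x : ℂ) - ((y - q : ℝ) * Complex.I))⁻¹).im := by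
  unfold areaKernel
  congr 2
  · ring_nf
  · rw [map_inv₀]
    congr 1
    simp
    ring

/-- The poles lie on opposite sides of the real line exactly when q < y. The excluded heights are
those with a pole on the line, or possibly a double pole. -/
theorem integral_areaKernel_horizontal {c q y : ℝ} (hy : 0 < y) (hyq : y ≠ q) (hyq' : 2 * y ≠ q) :
    ∫ x : ℝ, areaKernel c (q * Complex.I) (x + y * Complex.I) =
      if q < y then -(2 * Real.pi * c) / (c ^ 2 + (2 * y - q) ^ 2) else 0 := by
  simp only [areaKernel_add_mul_I]
  have h₁ : ((c : ℂ) - y * Complex.I).im < 0 := by simpa using hy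
  have him : (((y - q : ℝ) : ℂ) * Complex.I).im = y - q := by simp
  have hi := integrable_inv_sub_mul_inv_sub (w₂ := ((y - q : ℝ) : ℂ) * Complex.I) h₁.ne
    (by rw [him]; exact sub_ne_zero.2 hyq)
  have hcomm := Complex.imCLM.integral_comp_comm hi
  simp only [Complex.imCLM_apply] at hcomm
  rw [hcomm]
  split_ifs with hlt
  · rw [integral_inv_sub_mul_inv_sub_of_im_neg_of_im_pos h₁ (by rw [him]; linarith)]
    rw [Complex.div_im, Complex.normSq_apply]
    simp
    ring
  · rw [integral_inv_sub_mul_inv_sub_of_im_neg_of_im_neg h₁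
      (by rw [him]; exact sub_neg.2 (lt_of_le_of_ne (not_lt.1 hlt) hyq))]
    · simp
    · intro h
      have := congrArg Complex.im h
      simp at this
      exact hyq' (by linarith)

theorem hasDerivAt_arctan_div {c q y : ℝ} (h : 0 < 2 * y - q) :
    HasDerivAt (fun y => Real.pi * Real.arctan (c / (2 * y - q)))
      (-(2 * Real.pi * c) / (c ^ 2 + (2 * y - q) ^ 2)) y := by
  have h1 : HasDerivAt (fun y : ℝ => 2 * y - q) 2 y := by
    simpa using ((hasDerivAt_id y).const_mul 2).sub_const q
  simp only [div_eq_mul_inv c]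
  refine (((h1.fun_inv h.ne').const_mul c).arctan.const_mul Real.pi).congr_deriv ?_
  have : 0 < c ^ 2 + (2 * y - q) ^ 2 := by positivity
  field_simp
  ring

theorem ofReal_ne_mul_I {c q : ℝ} (hq : q ≠ 0) : (c : ℂ) ≠ q * Complex.I := fun h =>
  hq (by simpa using (congrArg Complex.im h).symm)

theorem setIntegral_areaKernel {c q : ℝ} (hq : q ≠ 0) :
    ∫ t in upperHalf, areaKernel c (q * Complex.I) t = -(Real.pi * Real.arctan (c / |q|)) := by
  have hint := integrable_areaKernel (ofReal_ne_mul_I (c := c) hq)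
  set e := Complex.measurableEquivRealProd.symm with he
  have hmp : MeasurePreserving e := Complex.volume_preserving_equiv_real_prod.symm
  have hpre : e ⁻¹' upperHalf = Set.univ ×ˢ Set.Ioi 0 := by
    ext z
    simp [upperHalf, he, Complex.measurableEquivRealProd_symm_apply]
  have hG : Integrable (fun z : ℝ × ℝ => areaKernel c (q * Complex.I) (e z))
      ((volume : Measure ℝ).prod ((volume : Measure ℝ).restrict (Set.Ioi 0))) := by
    have h := ((hmp.integrable_comp_emb e.measurableEmbedding).2 hint).integrableOn
      (s := Set.univ ×ˢ Set.Ioi 0)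
    rw [IntegrableOn, Measure.volume_eq_prod, ← Measure.prod_restrict, Measure.restrict_univ] at h
    exact h
  rw [← hmp.setIntegral_preimage_emb e.measurableEmbedding, hpre, Measure.volume_eq_prod,
    ← Measure.prod_restrict, Measure.restrict_univ, integral_prod_symm _ hG]
  have hae : (fun y => ∫ x, areaKernel c (q * Complex.I) (e (x, y))) =ᵐ[volume.restrict (Set.Ioi 0)]
      (Set.Ioi q).indicator (fun y => -(2 * Real.pi * c) / (c ^ 2 + (2 * y - q) ^ 2)) := by
    filter_upwards [ae_restrict_mem measurableSet_Ioi,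
      ae_restrict_of_ae (Measure.ae_ne volume q),
      ae_restrict_of_ae (Measure.ae_ne volume (q / 2))] with y hy hy1 hy2
    have hxy : ∀ x : ℝ, e (x, y) = x + y * Complex.I := fun x => by
      rw [he, Complex.measurableEquivRealProd_symm_apply, Complex.mk_eq_add_mul_I]
    simp only [hxy]
    rw [integral_areaKernel_horizontal hy hy1 (fun h => hy2 (by linarith))]
    simp [Set.indicator_apply]
  -- Fubini already supplies integrability in y.
  have hI : IntegrableOn (fun y => -(2 * Real.pi * c) / (c ^ 2 + (2 * y - q) ^ 2))
      (Set.Ioi (max 0 q)) := by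
    have h := hG.integral_prod_right.congr hae
    rw [integrable_indicator_iff measurableSet_Ioi, IntegrableOn,
      Measure.restrict_restrict measurableSet_Ioi, Set.Ioi_inter_Ioi, max_comm] at h
    exact h
  rw [integral_congr_ae hae, integral_indicator measurableSet_Ioi,
    Measure.restrict_restrict measurableSet_Ioi, Set.Ioi_inter_Ioi, sup_comm]
  -- The primitive is evaluated at the lower endpoint max(0, q), which produces |q|; hence i and -i
  -- contribute equally.
  have habs : 2 * max 0 q - q = |q| := by
    rcases le_total 0 q with h | h
    · rw [max_eq_right h, abs_of_nonneg h]; ring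
    · rw [max_eq_left h, abs_of_nonpos h]; ring
  have hpos : 0 < |q| := abs_pos.2 hq
  have hderiv : ∀ y ∈ Set.Ici (max 0 q), HasDerivAt
      (fun y => Real.pi * Real.arctan (c / (2 * y - q)))
      (-(2 * Real.pi * c) / (c ^ 2 + (2 * y - q) ^ 2)) y := fun y hy => hasDerivAt_arctan_div (by
    have : max 0 q ≤ y := hy
    linarith)
  have hlim : Tendsto (fun y => Real.pi * Real.arctan (c / (2 * y - q))) atTop (𝓝 0) := by
    have h1 : Tendsto (fun y : ℝ => 2 * y - q) atTop atTop :=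
      tendsto_atTop_add_const_right _ _ (tendsto_id.const_mul_atTop two_pos)
    have h2 := (Real.continuous_arctan.tendsto 0).comp (h1.const_div_atTop c)
    simpa [Function.comp_def] using h2.const_mul Real.pi
  rw [integral_Ioi_of_hasDerivAt_of_tendsto' hderiv hI hlim, habs, zero_sub]

/-! ### Intersection points with the toric boundary -/

theorem puncturedNhds_coe (z : ℂ) : puncturedNhds (z : OnePoint ℂ) = 𝓝[≠] z := by
  have h : ((↑) : ℂ → OnePoint ℂ) ⁻¹' {(z : OnePoint ℂ)}ᶜ = {z}ᶜ := by
    ext t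
    simp
  rw [puncturedNhds, OnePoint.nhdsWithin_coe, h, comap_map OnePoint.coe_injective]

theorem puncturedNhds_infty : puncturedNhds OnePoint.infty = cocompact ℂ := by
  rw [puncturedNhds, OnePoint.nhdsNE_infty_eq, comap_map OnePoint.coe_injective,
    coclosedCompact_eq_cocompact]

theorem im_eq_zero_of_tendsto {l : Filter ℂ} {m : Filter ℝ} [NeBot m]
    (h : Tendsto (fun x : ℝ => (x : ℂ)) m l) {f : ℂ → ℂ} (hf : ∀ x : ℝ, (f x).im = 0) {w : ℂ}
    (hw : Tendsto f l (𝓝 w)) : w.im = 0 := by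
  have h1 := (Complex.continuous_im.tendsto w).comp (hw.comp h)
  simp only [Function.comp_def, hf] at h1
  exact (tendsto_nhds_unique h1 tendsto_const_nhds)

theorem im_psiCurve_monomial_ofReal (m₁ m₂ m₃ k : ℕ) (a b : ℤ) (x : ℝ) :
    ((psiCurve m₁ m₂ m₃ k x).1 ^ a * (psiCurve m₁ m₂ m₃ k x).2 ^ b).im = 0 := by
  have : (psiCurve m₁ m₂ m₃ k x).1 ^ a * (psiCurve m₁ m₂ m₃ k x).2 ^ b =
      ((((x - cParam m₁ k) ^ m₁) ^ a * ((x - cParam m₁ k) ^ (2 * m₂) *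
        (x ^ 2 + 1) ^ ((m₃ : ℤ) - (m₂ : ℤ))) ^ b : ℝ) : ℂ) := by
    simp only [psiCurve]
    push_cast
    rfl
  rw [this, Complex.ofReal_im]

theorem zpow_exponent_eq_zero_of_tendsto {f : ℂ → ℂ} {l : Filter ℂ} [NeBot l] {N : ℤ} {w : ℂ}
    (hw : w ≠ 0) (hf : Tendsto f l (𝓝 0)) (h : Tendsto (fun t => f t ^ N) l (𝓝 w)) : N = 0 := by
  have key : ∀ (M : ℕ) (v : ℂ), v ≠ 0 → Tendsto (fun t => f t ^ M) l (𝓝 v) → M = 0 := by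
    intro M v hv hM
    by_contra h0
    have := hf.pow M
    rw [zero_pow h0] at this
    exact hv (tendsto_nhds_unique hM this)
  rcases N.eq_nat_or_neg with ⟨M, rfl | rfl⟩
  · simp only [zpow_natCast] at h
    simp [key M w hw h]
  · simp only [zpow_neg, zpow_natCast] at h
    have h' := h.inv₀ hw
    simp only [inv_inv] at h'
    simp [key M _ (inv_ne_zero hw) h']

theorem angle_mem_Ioo {m₁ k : ℕ} (hk : k < m₁) :
    Real.pi * (2 * k + 1) / (2 * m₁) ∈ Set.Ioo 0 Real.pi := by
  have hm : (0 : ℝ) < m₁ := by exact_mod_cast (Nat.zero_le k).trans_lt hk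
  have hkm : (k : ℝ) + 1 ≤ m₁ := by exact_mod_cast hk
  constructor
  · positivity
  · rw [div_lt_iff₀ (by positivity)]
    exact mul_lt_mul_of_pos_left (by linarith) Real.pi_pos

theorem I_sub_cParam {m₁ k : ℕ} (hk : k < m₁) :
    Complex.I - cParam m₁ k = -(Real.sin (Real.pi * (2 * k + 1) / (2 * m₁)) : ℂ)⁻¹ *
      Complex.exp (-((Real.pi * (2 * k + 1) / (2 * m₁) : ℝ) * Complex.I)) := by
  obtain ⟨h0, h1⟩ := angle_mem_Ioo hk
  have hs : (Real.sin (Real.pi * (2 * k + 1) / (2 * m₁)) : ℂ) ≠ 0 := by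
    exact_mod_cast (Real.sin_pos_of_pos_of_lt_pi h0 h1).ne'
  rw [cParam, Real.cot_eq_cos_div_sin, ← neg_mul, ← Complex.ofReal_neg, Complex.exp_mul_I,
    ← Complex.ofReal_cos, ← Complex.ofReal_sin, Real.cos_neg, Real.sin_neg]
  push_cast at hs ⊢
  field_simp
  ring

theorem im_I_sub_cParam_pow {m₁ k : ℕ} (hk : k < m₁) :
    ((Complex.I - cParam m₁ k) ^ (2 * m₁)).im = 0 := by
  have hm : (m₁ : ℂ) ≠ 0 := by exact_mod_cast (Nat.zero_le k).trans_lt hk |>.ne'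
  have he : ((2 * m₁ : ℕ) : ℂ) * -((Real.pi * (2 * k + 1) / (2 * m₁) : ℝ) * Complex.I) =
      -((2 * k + 1 : ℕ) * (Real.pi * Complex.I)) := by
    push_cast
    field_simp
  rw [I_sub_cParam hk, mul_pow, ← Complex.exp_nat_mul, he, Complex.exp_neg, Complex.exp_nat_mul,
    Complex.exp_pi_mul_I]
  rw [← Complex.ofReal_inv, ← Complex.ofReal_neg, ← Complex.ofReal_pow, Complex.im_ofReal_mul,
    Odd.neg_one_pow ⟨k, rfl⟩]
  simp

theorem im_sub_cParam_pow {m₁ k : ℕ} (hk : k < m₁) {z : ℂ} (hz : z ^ 2 + 1 = 0) :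
    ((z - cParam m₁ k) ^ (2 * m₁)).im = 0 := by
  have h : z ^ 2 = Complex.I ^ 2 := by rw [Complex.I_sq]; linear_combination hz
  rcases sq_eq_sq_iff_eq_or_eq_neg.1 h with rfl | rfl
  · exact im_I_sub_cParam_pow hk
  · have e : -Complex.I - cParam m₁ k = conj (Complex.I - cParam m₁ k) := by simp
    rw [e, ← map_pow, Complex.conj_im, im_I_sub_cParam_pow hk, neg_zero]

theorem not_meetsBoundaryAt_of_continuousAt {φ : ℂ → ℂ × ℂ} {z : ℂ} (h : ContinuousAt φ z)
    (h₁ : (φ z).1 ≠ 0) (h₂ : (φ z).2 ≠ 0) : ¬ MeetsBoundaryAt φ z := by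
  rw [MeetsBoundaryAt, not_not, puncturedNhds_coe]
  exact ⟨φ z, h₁, h₂, h.tendsto.mono_left nhdsWithin_le_nhds⟩

theorem sub_ofReal_ne_zero {z : ℂ} (hz : z.im ≠ 0) (c : ℝ) : z - c ≠ 0 := fun h =>
  hz (by simpa using congrArg Complex.im h)

theorem hasRealOrImaginaryBoundary_psiCurve {m₁ k : ℕ} (hk : k < m₁) (m₂ m₃ : ℕ) :
    HasRealOrImaginaryBoundary (psiCurve m₁ m₂ m₃ k) := by
  intro p hp a b w hw hlim
  have sq_real : w.im = 0 → (w ^ 2).im = 0 := fun h => by simp [sq, h]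
  induction p using OnePoint.rec with
  | infty =>
    rw [puncturedNhds_infty] at hlim
    exact sq_real (im_eq_zero_of_tendsto (m := cocompact ℝ)
      Complex.isometry_ofReal.isClosedEmbedding.tendsto_cocompact
      (im_psiCurve_monomial_ofReal m₁ m₂ m₃ k a b) hlim)
  | coe z =>
    rw [puncturedNhds_coe] at hlim
    by_cases hz : z.im = 0
    · obtain ⟨r, rfl⟩ : ∃ r : ℝ, (r : ℂ) = z := ⟨z.re, Complex.ext rfl hz.symm⟩
      refine sq_real (im_eq_zero_of_tendsto (m := 𝓝[≠] r) ?_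
        (im_psiCurve_monomial_ofReal m₁ m₂ m₃ k a b) hlim)
      exact Complex.continuous_ofReal.continuousWithinAt.tendsto_nhdsWithin
        fun x hx => by simpa using hx
    have hc := sub_ofReal_ne_zero hz (cParam m₁ k)
    -- Off the real line only ±i can meet the boundary, and only if the exponent m₃ - m₂ is nonzero.
    by_cases h : z ^ 2 + 1 ≠ 0 ∨ (m₃ : ℤ) - m₂ = 0
    · refine absurd hp (not_meetsBoundaryAt_of_continuousAt ?_ (pow_ne_zero _ hc)
        (mul_ne_zero (pow_ne_zero _ hc) ?_))
      · have h1 : ContinuousAt (fun t : ℂ => (t ^ 2 + 1) ^ ((m₃ : ℤ) - m₂)) z := by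
          refine ContinuousAt.zpow₀ (by fun_prop) _ ?_
          exact h.imp id fun h => h.ge
        unfold psiCurve
        fun_prop
      · rcases h with h | h
        · exact zpow_ne_zero _ h
        · simp [h]
    push Not at h
    obtain ⟨hz1, hn⟩ := h
    -- Dividing out the powers of t - c leaves (t² + 1)^((m₃ - m₂)b), which has a nonzero limit
    -- although its base tends to 0.
    have hb : b = 0 := by
      have hG : ContinuousAt (fun t : ℂ => ((t - cParam m₁ k) ^ m₁) ^ a *
          ((t - cParam m₁ k) ^ (2 * m₂)) ^ b) z := by
        refine ContinuousAt.mul (ContinuousAt.zpow₀ (by fun_prop) _ (Or.inl (pow_ne_zero _ hc)))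
          (ContinuousAt.zpow₀ (by fun_prop) _ (Or.inl (pow_ne_zero _ hc)))
      have hGz := mul_ne_zero (zpow_ne_zero a (pow_ne_zero m₁ hc))
        (zpow_ne_zero b (pow_ne_zero (2 * m₂) hc))
      have hdiv := hlim.div (hG.tendsto.mono_left nhdsWithin_le_nhds) hGz
      have hf : Tendsto (fun t : ℂ => t ^ 2 + 1) (𝓝[≠] z) (𝓝 0) := by
        have : ContinuousAt (fun t : ℂ => t ^ 2 + 1) z := by fun_prop
        have h := this.tendsto.mono_left (nhdsWithin_le_nhds (s := {z}ᶜ))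
        rwa [hz1] at h
      have := zpow_exponent_eq_zero_of_tendsto (N := ((m₃ : ℤ) - m₂) * b) (div_ne_zero hw hGz) hf
        (hdiv.congr' ?_)
      · exact (mul_eq_zero.1 this).resolve_left hn
      · filter_upwards [nhdsWithin_le_nhds (hG.eventually_ne hGz)] with t ht
        simp only [psiCurve, Pi.div_apply, mul_zpow, zpow_mul]
        rw [← mul_assoc, mul_div_cancel_left₀ _ ht]
    subst hb
    have hcont : ContinuousAt (fun t : ℂ => ((t - cParam m₁ k) ^ m₁) ^ a) z :=
      ContinuousAt.zpow₀ (by fun_prop) _ (Or.inl (pow_ne_zero _ hc))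
    simp only [psiCurve, zpow_zero, mul_one] at hlim
    -- Here w² = ((z - c)^(2m₁))^a, an integer power of a real number.
    rw [tendsto_nhds_unique hlim (hcont.tendsto.mono_left nhdsWithin_le_nhds), ← zpow_natCast,
      zpow_comm, zpow_natCast, ← pow_mul, mul_comm m₁ 2,
      ← Complex.conj_eq_iff_im, map_zpow₀, Complex.conj_eq_iff_im.2 (im_sub_cParam_pow hk hz1)]

theorem isRealRationalCurve_psiCurve (m₁ m₂ m₃ k : ℕ) (hm : 0 < m₂) :
    IsRealRationalCurve (psiCurve m₁ m₂ m₃ k) := by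
  have h1 := Polynomial.X_sub_C_ne_zero (cParam m₁ k)
  have h2 : (Polynomial.X ^ 2 + Polynomial.C 1 : Polynomial ℝ) ≠ 0 :=
    Polynomial.X_pow_add_C_ne_zero two_pos 1
  refine ⟨⟨(Polynomial.X - Polynomial.C (cParam m₁ k)) ^ m₁, 1, pow_ne_zero _ h1, one_ne_zero,
    fun t _ => by simp [psiCurve]⟩, ⟨(Polynomial.X - Polynomial.C (cParam m₁ k)) ^ (2 * m₂) *
      (Polynomial.X ^ 2 + Polynomial.C 1) ^ m₃, (Polynomial.X ^ 2 + Polynomial.C 1) ^ m₂,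
      mul_ne_zero (pow_ne_zero _ h1) (pow_ne_zero _ h2), pow_ne_zero _ h2, fun t ht => ?_⟩⟩
  -- The fraction is left unreduced: as m₂ > 0, its denominator excludes ±i even when m₃ ≥ m₂.
  have ht' : t ^ 2 + 1 ≠ 0 := by
    intro h
    apply ht
    simp [h, hm.ne']
  simp [psiCurve, zpow_sub₀ ht', mul_div_assoc]

/-! ### The areas of the two curves -/

theorem measurableSet_upperHalf : MeasurableSet upperHalf :=
  measurableSet_lt measurable_const Complex.measurable_im

/-- The torus part may or may not contain i (for ψ_k it does exactly when m₂ = m₃), so T is only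
pinned down up to this null set. -/
theorem integrable_and_setIntegral_upperHalf (A C c : ℝ) {D : ℂ → ℝ} {T : Set ℂ}
    (hT : T ⊆ upperHalf) (hT' : ∀ t ∈ upperHalf, t ≠ Complex.I → t ∈ T)
    (hD : ∀ t ∈ upperHalf, t ≠ Complex.I → D t = A * C *
      (areaKernel c ((1 : ℝ) * Complex.I) t + areaKernel c ((-1 : ℝ) * Complex.I) t)) :
    IntegrableOn D T ∧ ∫ t in T, D t = A * C * (-(2 * Real.pi * Real.arctan c)) := by
  have hTe : T =ᵐ[volume] upperHalf := by
    filter_upwards [Measure.ae_ne volume Complex.I] with t ht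
    exact propext ⟨fun h => hT h, fun h => hT' t h ht⟩
  have hDe : (fun t => A * C * (areaKernel c ((1 : ℝ) * Complex.I) t +
      areaKernel c ((-1 : ℝ) * Complex.I) t)) =ᵐ[volume.restrict upperHalf] D := by
    filter_upwards [ae_restrict_mem measurableSet_upperHalf,
      ae_restrict_of_ae (Measure.ae_ne volume Complex.I)] with t ht ht'
    exact (hD t ht ht').symm
  have h1 := (integrable_areaKernel (ofReal_ne_mul_I (c := c) one_ne_zero)).integrableOn
    (s := upperHalf)
  have h2 := (integrable_areaKernel (ofReal_ne_mul_I (c := c)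
    (neg_ne_zero.2 one_ne_zero))).integrableOn (s := upperHalf)
  rw [integrableOn_congr_set_ae hTe, setIntegral_congr_set hTe, ← integral_congr_ae hDe]
  refine ⟨((h1.add h2).const_mul (A * C)).congr hDe, ?_⟩
  rw [integral_const_mul, integral_add h1 h2, setIntegral_areaKernel one_ne_zero,
    setIntegral_areaKernel (neg_ne_zero.2 one_ne_zero), abs_neg, abs_one, div_one]
  ring

theorem im_mul_conj_eq_areaKernel (A B C c : ℝ) (t : ℂ) :
    ((A : ℂ) * (t - c)⁻¹ * conj (B * (t - c)⁻¹ +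
      C * ((t - Complex.I)⁻¹ + (t + Complex.I)⁻¹))).im =
    A * C * (areaKernel c ((1 : ℝ) * Complex.I) t + areaKernel c ((-1 : ℝ) * Complex.I) t) := by
  have e : t - ((-1 : ℝ) : ℂ) * Complex.I = t + Complex.I := by push_cast; ring
  have e' : t - ((1 : ℝ) : ℂ) * Complex.I = t - Complex.I := by push_cast; ring
  rw [areaKernel, areaKernel, e, e']
  simp only [map_add, map_mul, Complex.conj_ofReal, Complex.add_im, Complex.mul_im,
    Complex.mul_re, Complex.add_re, Complex.ofReal_re, Complex.ofReal_im, Complex.conj_re,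
    Complex.conj_im]
  ring

theorem hasLogArea_and_hasArgArea {φ z' : ℂ → ℂ × ℂ} (A B C c : ℝ)
    (h₁ : ∀ t ∈ upperHalf, t ≠ Complex.I → HasDerivAt (fun s => (φ s).1) (z' t).1 t)
    (h₂ : ∀ t ∈ upperHalf, t ≠ Complex.I → HasDerivAt (fun s => (φ s).2) (z' t).2 t)
    (h₁0 : ∀ t ∈ upperHalf, t ≠ Complex.I → (φ t).1 ≠ 0)
    (h₂0 : ∀ t ∈ upperHalf, t ≠ Complex.I → (φ t).2 ≠ 0)
    (e₁ : ∀ t ∈ upperHalf, t ≠ Complex.I → (z' t).1 / (φ t).1 = A * (t - c)⁻¹)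
    (e₂ : ∀ t ∈ upperHalf, t ≠ Complex.I → (z' t).2 / (φ t).2 =
      B * (t - c)⁻¹ + C * ((t - Complex.I)⁻¹ + (t + Complex.I)⁻¹)) :
    HasLogArea φ upperHalf (A * C * (-(2 * Real.pi * Real.arctan c))) ∧
      HasArgArea φ upperHalf (A * C * (-(2 * Real.pi * Real.arctan c))) := by
  have hT : torusPart φ upperHalf ⊆ upperHalf := fun t ht => ht.1
  have hT' : ∀ t ∈ upperHalf, t ≠ Complex.I → t ∈ torusPart φ upperHalf :=
    fun t ht hI => ⟨ht, h₁0 t ht hI, h₂0 t ht hI⟩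
  constructor
  · refine integrable_and_setIntegral_upperHalf A C c hT hT' fun t ht hI => ?_
    rw [logDensity_eq (h₁ t ht hI) (h₂ t ht hI) (h₁0 t ht hI) (h₂0 t ht hI), e₁ t ht hI,
      e₂ t ht hI, im_mul_conj_eq_areaKernel]
  · refine integrable_and_setIntegral_upperHalf A C c hT hT' fun t ht hI => ?_
    rw [argDensity_eq (h₁ t ht hI) (h₂ t ht hI) (h₁0 t ht hI) (h₂0 t ht hI), e₁ t ht hI,
      e₂ t ht hI, im_mul_conj_eq_areaKernel]

theorem sq_add_one_eq (t : ℂ) : t ^ 2 + 1 = (t - Complex.I) * (t + Complex.I) := by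
  linear_combination Complex.I_sq

theorem add_I_ne_zero {t : ℂ} (ht : t ∈ upperHalf) : t + Complex.I ≠ 0 := fun h => by
  have h1 := congrArg Complex.im h
  have h2 : 0 < t.im := ht
  simp at h1
  linarith

theorem sq_add_one_ne_zero {t : ℂ} (ht : t ∈ upperHalf) (hI : t ≠ Complex.I) : t ^ 2 + 1 ≠ 0 := by
  rw [sq_add_one_eq]
  exact mul_ne_zero (sub_ne_zero.2 hI) (add_I_ne_zero ht)

theorem inv_sub_I_add_inv_add_I {t : ℂ} (ht : t ∈ upperHalf) (hI : t ≠ Complex.I) :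
    (t - Complex.I)⁻¹ + (t + Complex.I)⁻¹ = 2 * t / (t ^ 2 + 1) := by
  have h1 := sub_ne_zero.2 hI
  have h2 := add_I_ne_zero ht
  rw [sq_add_one_eq]
  field_simp
  ring

theorem arctan_cParam {m₁ k : ℕ} (hk : k < m₁) :
    Real.arctan (cParam m₁ k) = Real.pi / 2 - Real.pi * (2 * k + 1) / (2 * m₁) := by
  obtain ⟨h0, h1⟩ := angle_mem_Ioo hk
  rw [cParam, ← Real.tan_inv_eq_cot, ← Real.tan_pi_div_two_sub,
    Real.arctan_tan (by linarith) (by linarith)]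

theorem hasDerivAt_sub_const_pow (c : ℂ) (n : ℕ) (t : ℂ) :
    HasDerivAt (fun s => (s - c) ^ n) (n * (t - c) ^ (n - 1)) t := by
  simpa using ((hasDerivAt_id t).sub_const c).fun_pow n

theorem hasDerivAt_sq_add_one (t : ℂ) : HasDerivAt (fun s : ℂ => s ^ 2 + 1) (2 * t) t := by
  simpa using (hasDerivAt_pow 2 t).add_const 1

theorem natCast_mul_pow_pred_div {x : ℂ} (hx : x ≠ 0) (n : ℕ) :
    n * x ^ (n - 1) / x ^ n = n * x⁻¹ := by
  rcases n with _ | n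
  · simp
  · simp only [Nat.add_sub_cancel, pow_succ]
    field_simp

theorem phiCurve_areas (m₁ k : ℕ) :
    HasLogArea (phiCurve m₁ k) upperHalf (-(2 * Real.pi * Real.arctan (cParam m₁ k))) ∧
      HasArgArea (phiCurve m₁ k) upperHalf (-(2 * Real.pi * Real.arctan (cParam m₁ k))) := by
  have hc : ∀ t ∈ upperHalf, t - cParam m₁ k ≠ 0 := fun t ht =>
    sub_ofReal_ne_zero (ne_of_gt ht) _
  have h := hasLogArea_and_hasArgArea (φ := phiCurve m₁ k) (z' := fun t => (1,
    (2 * t * (t - cParam m₁ k) - (t ^ 2 + 1) * 1) / (t - cParam m₁ k) ^ 2)) 1 (-1) 1 (cParam m₁ k)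
    (fun t _ _ => (hasDerivAt_id t).sub_const _)
    (fun t ht _ => (hasDerivAt_sq_add_one t).fun_div ((hasDerivAt_id t).sub_const _) (hc t ht))
    (fun t ht _ => hc t ht)
    (fun t ht hI => div_ne_zero (sq_add_one_ne_zero ht hI) (hc t ht))
    (fun t ht _ => by simp [phiCurve])
    (fun t ht hI => by
      have h1 := hc t ht
      have h2 := sq_add_one_ne_zero ht hI
      rw [inv_sub_I_add_inv_add_I ht hI]
      simp only [phiCurve]
      push_cast
      field_simp
      ring)
  simpa using h

theorem psiCurve_areas (m₁ m₂ m₃ k : ℕ) :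
    HasLogArea (psiCurve m₁ m₂ m₃ k) upperHalf
        (m₁ * ((m₃ : ℝ) - m₂) * (-(2 * Real.pi * Real.arctan (cParam m₁ k)))) ∧
      HasArgArea (psiCurve m₁ m₂ m₃ k) upperHalf
        (m₁ * ((m₃ : ℝ) - m₂) * (-(2 * Real.pi * Real.arctan (cParam m₁ k)))) := by
  have hc : ∀ t ∈ upperHalf, t - cParam m₁ k ≠ 0 := fun t ht =>
    sub_ofReal_ne_zero (ne_of_gt ht) _
  refine hasLogArea_and_hasArgArea (φ := psiCurve m₁ m₂ m₃ k) (z' := fun t =>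
    (m₁ * (t - cParam m₁ k) ^ (m₁ - 1),
      (2 * m₂ : ℕ) * (t - cParam m₁ k) ^ (2 * m₂ - 1) * (t ^ 2 + 1) ^ ((m₃ : ℤ) - (m₂ : ℤ)) +
        (t - cParam m₁ k) ^ (2 * m₂) * (((m₃ : ℤ) - (m₂ : ℤ) : ℤ) *
          (t ^ 2 + 1) ^ ((m₃ : ℤ) - (m₂ : ℤ) - 1) * (2 * t)))) m₁ (2 * m₂) ((m₃ : ℝ) - m₂)
    (cParam m₁ k) ?_ ?_ ?_ ?_ ?_ ?_
  · exact fun t _ _ => hasDerivAt_sub_const_pow _ _ t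
  · intro t ht hI
    have h := HasDerivAt.comp (h₂ := fun s : ℂ => s ^ ((m₃ : ℤ) - (m₂ : ℤ))) t
      (hasDerivAt_zpow _ _ (Or.inl (sq_add_one_ne_zero ht hI))) (hasDerivAt_sq_add_one t)
    exact (hasDerivAt_sub_const_pow _ _ t).fun_mul h
  · exact fun t ht _ => pow_ne_zero _ (hc t ht)
  · exact fun t ht hI => mul_ne_zero (pow_ne_zero _ (hc t ht))
      (zpow_ne_zero _ (sq_add_one_ne_zero ht hI))
  · exact fun t ht _ => by simpa [psiCurve] using natCast_mul_pow_pred_div (hc t ht) m₁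
  · intro t ht hI
    have h1 := hc t ht
    have h2 := sq_add_one_ne_zero ht hI
    have h3 := natCast_mul_pow_pred_div h1 (2 * m₂)
    rw [inv_sub_I_add_inv_add_I ht hI]
    simp only [psiCurve]
    rw [add_div, mul_div_mul_right _ _ (zpow_ne_zero _ h2), h3,
      mul_div_mul_left _ _ (pow_ne_zero _ h1), zpow_sub_one₀ h2]
    have h4 := zpow_ne_zero ((m₃ : ℤ) - (m₂ : ℤ)) h2
    push_cast
    congr 1
    field_simp

end QuantumIndex

theorem lemma3p5 (m₁ k : ℕ) (hk : k < m₁) :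
    QuantumIndex.HasLogArea (QuantumIndex.phiCurve m₁ k) QuantumIndex.upperHalf
        (((2 * k + 1 : ℝ) / m₁ - 1) * Real.pi ^ 2) ∧
      QuantumIndex.HasArgArea (QuantumIndex.phiCurve m₁ k) QuantumIndex.upperHalf
        (((2 * k + 1 : ℝ) / m₁ - 1) * Real.pi ^ 2) ∧
      ∀ m₂ m₃ : ℕ, 0 < m₂ → 0 < m₃ →
        QuantumIndex.IsQuantumIndex QuantumIndex.upperHalf (QuantumIndex.psiCurve m₁ m₂ m₃ k)
          (((m₃ : ℚ) - m₂) * (2 * k + 1 - m₁)) := by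
  have hm : (m₁ : ℝ) ≠ 0 := by exact_mod_cast ((Nat.zero_le k).trans_lt hk).ne'
  have hA : -(2 * Real.pi * Real.arctan (QuantumIndex.cParam m₁ k)) =
      ((2 * k + 1 : ℝ) / m₁ - 1) * Real.pi ^ 2 := by
    rw [QuantumIndex.arctan_cParam hk]
    field_simp
    ring
  obtain ⟨h1, h2⟩ := QuantumIndex.phiCurve_areas m₁ k
  rw [hA] at h1 h2
  refine ⟨h1, h2, fun m₂ m₃ hm₂ _ => ?_⟩
  obtain ⟨h3, h4⟩ := QuantumIndex.psiCurve_areas m₁ m₂ m₃ k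
  have hB : m₁ * ((m₃ : ℝ) - m₂) * (-(2 * Real.pi * Real.arctan (QuantumIndex.cParam m₁ k))) =
      ((((m₃ : ℚ) - m₂) * (2 * k + 1 - m₁) : ℚ) : ℝ) * Real.pi ^ 2 := by
    rw [hA]
    push_cast
    field_simp
  rw [hB] at h3 h4
  exact ⟨Or.inl rfl, QuantumIndex.isRealRationalCurve_psiCurve m₁ m₂ m₃ k hm₂,
    QuantumIndex.hasRealOrImaginaryBoundary_psiCurve hk m₂ m₃,
    -- The index is in fact an integer, so the numerator over 2 is its double.
    ⟨2 * (((m₃ : ℤ) - m₂) * (2 * k + 1 - m₁)), by push_cast; ring⟩, h3, h4⟩
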